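/- Let $n$ be a natural number and let $P \in M_n(\mathbb C)$ be positive semidefinite. For a complex matrix $X=(X_{ij}) \in M_n(\mathbb C)$ consider the bilinear form $B_X(a,b)=\sum_{i,j} a_i X_{ij} b_j$ on $\mathcal A_n \times \mathcal A_n$, where $\mathcal A_n=(\mathbb C^n,\|\cdot\|_\infty)$ is the $n$-dimensional abelian C*-algebra. Let $$\|X\|_B=\sup\{|B_X(a,b)| : \|a\|_\infty\le 1,\ \|b\|_\infty\le 1\}$$ be its norm, and let $\|X\|_{cbB}$ be its completely bounded norm, that is, the supremum over all integers $k \ge 1$ and all $a, b$ in the unit ball of the C*-algebra $M_k(\mathcal A_n)$ of the operator norms of the matrices $$\Big(\sum_{t=1}^k B_X(a_{rt},b_{ts})\Big)_{r,s=1}^k \in M_k(\mathbb C).$$ Let $\mathcal Q_n$ be the set of positive semidefinite matrices in $M_n(\mathbb C)$ whose diagonal entries all equal $1$, and let $\mathcal R_n$ be the closed convex hull in $M_n(\mathbb C)$ of the set of matrices $(\overline{u_i}\,u_j)_{i,j}$ with $u\in\mathbb C^n$, $|u_i|=1$ for all $i$. Then there exist $R\in\mathcal R_n$ and $Q\in\mathcal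 Q_n$ such that $$\mathrm{Tr}(PR)=\|P\|_B \quad\text{and}\quad \mathrm{Tr}(PQ)=\|P\|_{cbB},$$ where $\mathrm{Tr}$ is the unnormalized trace. -/

import Mathlib

open scoped ComplexOrder

noncomputable section

namespace GrothendieckNorms

/-- The `n`-dimensional abelian C*-algebra of complex functions on `{1, …, n}`, with the
sup-norm and pointwise operations. -/
abbrev AbelianAlg (n : ℕ) : Type := Fin n → ℂ

/-- The bilinear form `(a, b) ↦ ∑ i, ∑ j, a i * X i j * b j` given by a complex matrix `X`. -/
def bilinForm {m n : ℕ} (X : Matrix (Fin m) (Fin n) ℂ) :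
    AbelianAlg m →ₗ[ℂ] AbelianAlg n →ₗ[ℂ] ℂ :=
  Matrix.toLinearMap₂' ℂ X

/-- The norm of the bilinear form of `X`, for the sup-norms on both spaces. -/
def normB {m n : ℕ} (X : Matrix (Fin m) (Fin n) ℂ) : ℝ :=
  sSup {r : ℝ | ∃ (a : AbelianAlg m) (b : AbelianAlg n),
    ‖a‖ ≤ 1 ∧ ‖b‖ ≤ 1 ∧ r = ‖bilinForm X a b‖}

section CompletelyBounded

open scoped Matrix.Norms.L2Operator

/-- The operator norm of a complex `k × k` matrix acting on the Hilbert space `ℂ ^ k`. -/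
def opNorm {k : ℕ} (T : Matrix (Fin k) (Fin k) ℂ) : ℝ := ‖T‖

/-- The C*-norm on the `k × k` matrices over the abelian C*-algebra of functions on `{1, …, n}`:
the maximum over the points `j` of the operator norm of the scalar matrix of values at `j`. -/
def matNorm {k n : ℕ} (a : Matrix (Fin k) (Fin k) (AbelianAlg n)) : ℝ :=
  ‖fun j : Fin n => a.map (fun f : AbelianAlg n => f j)‖

end CompletelyBounded

/-- The `k`-th amplification of a bilinear map into the scalars: the bilinear map on matrices
`(a, b) ↦ (∑ t, φ (a r t) (b t s))_{r, s}`, modelled on the matrix product. -/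
def amplify {m n : ℕ} (φ : AbelianAlg m →ₗ[ℂ] AbelianAlg n →ₗ[ℂ] ℂ) (k : ℕ)
    (a : Matrix (Fin k) (Fin k) (AbelianAlg m)) (b : Matrix (Fin k) (Fin k) (AbelianAlg n)) :
    Matrix (Fin k) (Fin k) ℂ :=
  Matrix.of fun r s => ∑ t, φ (a r t) (b t s)

/-- The completely bounded norm of the bilinear form of `X`: the supremum over all `k` of the
norms of its amplifications. -/
def normCbB {m n : ℕ} (X : Matrix (Fin m) (Fin n) ℂ) : ℝ :=
  sSup {r : ℝ | ∃ (k : ℕ) (a : Matrix (Fin k) (Fin k) (AbelianAlg m))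
      (b : Matrix (Fin k) (Fin k) (AbelianAlg n)),
    matNorm a ≤ 1 ∧ matNorm b ≤ 1 ∧ r = opNorm (amplify (bilinForm X) k a b)}

theorem bilinForm_apply {m n : ℕ} (X : Matrix (Fin m) (Fin n) ℂ) (a : AbelianAlg m)
    (b : AbelianAlg n) : bilinForm X a b = ∑ i, ∑ j, a i * X i j * b j := by
  simp only [bilinForm, Matrix.toLinearMap₂'_apply, smul_eq_mul]
  refine Finset.sum_congr rfl fun i _ => Finset.sum_congr rfl fun j _ => ?_
  ring

theorem amplify_bilinForm {m n k : ℕ} (X : Matrix (Fin m) (Fin n) ℂ)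
    (a : Matrix (Fin k) (Fin k) (AbelianAlg m)) (b : Matrix (Fin k) (Fin k) (AbelianAlg n)) :
    amplify (bilinForm X) k a b =
      ∑ i, ∑ j, X i j • (a.map (fun f => f i) * b.map (fun f => f j)) := by
  ext r s
  simp only [amplify, Matrix.of_apply, bilinForm_apply, Matrix.sum_apply, Matrix.smul_apply,
    Matrix.mul_apply, Matrix.map_apply, smul_eq_mul, Finset.mul_sum]
  rw [Finset.sum_comm]
  refine Finset.sum_congr rfl fun i _ => ?_
  rw [Finset.sum_comm]
  refine Finset.sum_congr rfl fun j _ => Finset.sum_congr rfl fun t _ => ?_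
  ring

/-- The positive semidefinite complex `n × n` matrices with all diagonal entries equal to `1`. -/
def setQ (n : ℕ) : Set (Matrix (Fin n) (Fin n) ℂ) :=
  {X | X.PosSemidef ∧ ∀ i, X i i = 1}

/-- The closed convex hull of the rank one matrices with entries `conj (u i) * u j`, where `u` is
a unitary of the abelian C*-algebra (all entries of modulus one). -/
def setR (n : ℕ) : Set (Matrix (Fin n) (Fin n) ℂ) :=
  closure (convexHull ℝ
    {X | ∃ u : AbelianAlg n, u ∈ unitary (AbelianAlg n) ∧ X = Matrix.vecMulVec (star u) u})

/-- The set of values whose supremum is `normB X` is bounded. -/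
theorem bddAbove_normB {m n : ℕ} (X : Matrix (Fin m) (Fin n) ℂ) :
    BddAbove {r : ℝ | ∃ (a : AbelianAlg m) (b : AbelianAlg n),
      ‖a‖ ≤ 1 ∧ ‖b‖ ≤ 1 ∧ r = ‖bilinForm X a b‖} := by
  refine ⟨∑ i, ∑ j, ‖X i j‖, ?_⟩
  rintro r ⟨a, b, ha, hb, rfl⟩
  rw [bilinForm_apply]
  refine (norm_sum_le _ _).trans (Finset.sum_le_sum fun i _ => (norm_sum_le _ _).trans
    (Finset.sum_le_sum fun j _ => ?_))
  rw [norm_mul, norm_mul]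
  have h1 : ‖a i‖ ≤ 1 := (norm_le_pi_norm a i).trans ha
  have h2 : ‖b j‖ ≤ 1 := (norm_le_pi_norm b j).trans hb
  calc ‖a i‖ * ‖X i j‖ * ‖b j‖ ≤ 1 * ‖X i j‖ * 1 := by gcongr
    _ = ‖X i j‖ := by ring

open scoped Matrix.Norms.L2Operator in
/-- The set of values whose supremum is `normCbB X` is bounded. -/
theorem bddAbove_normCbB {m n : ℕ} (X : Matrix (Fin m) (Fin n) ℂ) :
    BddAbove {r : ℝ | ∃ (k : ℕ) (a : Matrix (Fin k) (Fin k) (AbelianAlg m))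
        (b : Matrix (Fin k) (Fin k) (AbelianAlg n)),
      matNorm a ≤ 1 ∧ matNorm b ≤ 1 ∧ r = opNorm (amplify (bilinForm X) k a b)} := by
  refine ⟨∑ i, ∑ j, ‖X i j‖, ?_⟩
  rintro r ⟨k, a, b, ha, hb, rfl⟩
  rw [amplify_bilinForm, opNorm]
  refine (norm_sum_le _ _).trans (Finset.sum_le_sum fun i _ => (norm_sum_le _ _).trans
    (Finset.sum_le_sum fun j _ => ?_))
  have h1 : ‖a.map (fun f => f i)‖ ≤ 1 :=
    (norm_le_pi_norm (fun j : Fin m => a.map (fun f : AbelianAlg m => f j)) i).trans ha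
  have h2 : ‖b.map (fun f => f j)‖ ≤ 1 :=
    (norm_le_pi_norm (fun j : Fin n => b.map (fun f : AbelianAlg n => f j)) j).trans hb
  calc ‖X i j • (a.map (fun f => f i) * b.map (fun f => f j))‖
      ≤ ‖X i j‖ * (‖a.map (fun f => f i)‖ * ‖b.map (fun f => f j)‖) := by
        rw [norm_smul]; gcongr; exact norm_mul_le _ _
    _ ≤ ‖X i j‖ * (1 * 1) := by gcongr
    _ = ‖X i j‖ := by ring

end GrothendieckNorms

end

open scoped ComplexOrder

noncomputable section

namespace GrothendieckNorms

open Matrix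

/-! Write `P = Cᴴ * C`. For families `x`, `y` of vectors in a Hilbert space, `∑ P i j ⟨x i, y j⟩ =
⟨C x, C y⟩`, so by Cauchy–Schwarz its supremum over families in the unit ball is the supremum of `‖C
x‖ ^ 2`. By compactness and convexity this is attained at a family of unit vectors, where the value
is the trace of `P` against the transposed Gram matrix of `x`. Scalar families give `normB`, with a
rank one Gram matrix (`exists_mem_setR`). Families in `ℂ ^ n` give `normCbB` (`exists_mem_setQ`):
matrix coefficients of amplifications are values of the form (`opNorm_amplify_le`), and the maximum
is itself an amplification (`exists_opNorm_amplify_eq`). -/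

open scoped MatrixOrder Matrix.Norms.L2Operator in
theorem _root_.Matrix.PosSemidef.exists_eq_conjTranspose_mul_self {ι : Type*} [Fintype ι]
    {P : Matrix ι ι ℂ} (hP : P.PosSemidef) : ∃ C : Matrix ι ι ℂ, P = Cᴴ * C := by
  classical
  exact CStarAlgebra.nonneg_iff_eq_star_mul_self.1 hP.nonneg

section Sesquilinear

variable {ι E : Type*} [Fintype ι] [NormedAddCommGroup E] [InnerProductSpace ℂ E]

/-- The sesquilinear form on families of vectors with coefficient matrix `P`. -/
def sesqForm (P : Matrix ι ι ℂ) (x y : ι → E) : ℂ :=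
  ∑ i, ∑ j, P i j * inner ℂ (x i) (y j)

/-- The action of a scalar matrix on families of vectors, with values in the Hilbert sum. -/
def matAction (C : Matrix ι ι ℂ) : (ι → E) →ₗ[ℂ] PiLp 2 (fun _ : ι => E) where
  toFun x := WithLp.toLp 2 fun l => ∑ i, C l i • x i
  map_add' x y := by
    ext l
    simp [Finset.sum_add_distrib]
  map_smul' c x := by
    ext l
    simp [Finset.smul_sum, smul_smul, mul_comm]

theorem sesqForm_conjTranspose_mul_self (C : Matrix ι ι ℂ) (x y : ι → E) :
    sesqForm (Cᴴ * C) x y = inner ℂ (matAction C x) (matAction C y) := by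
  simp only [sesqForm, matAction, LinearMap.coe_mk, AddHom.coe_mk, PiLp.inner_apply, sum_inner,
    inner_sum, inner_smul_left, inner_smul_right, mul_apply, conjTranspose_apply, Finset.sum_mul]
  have h : ∀ i j l, star (C l i) * C l j * inner ℂ (x i) (y j) =
      C l j * (starRingEnd ℂ (C l i) * inner ℂ (x i) (y j)) := fun i j l => by
    rw [starRingEnd_apply]; ring
  simp only [h]
  calc _ = ∑ i, ∑ l, ∑ j, C l j * (starRingEnd ℂ (C l i) * inner ℂ (x i) (y j)) :=
        Finset.sum_congr rfl fun i _ => Finset.sum_comm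
    _ = ∑ l, ∑ j, ∑ i, C l j * (starRingEnd ℂ (C l i) * inner ℂ (x i) (y j)) := by
        rw [Finset.sum_comm]
        exact Finset.sum_congr rfl fun l _ => Finset.sum_comm
    _ = _ := by simp only [Finset.mul_sum]

theorem sesqForm_self_eq_norm_sq (C : Matrix ι ι ℂ) (x : ι → E) :
    sesqForm (Cᴴ * C) x x = ((‖matAction C x‖ ^ 2 : ℝ) : ℂ) := by
  rw [sesqForm_conjTranspose_mul_self, inner_self_eq_norm_sq_to_K]
  norm_cast

theorem norm_sesqForm_le (C : Matrix ι ι ℂ) (x y : ι → E) :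
    ‖sesqForm (Cᴴ * C) x y‖ ≤ ‖matAction C x‖ * ‖matAction C y‖ := by
  rw [sesqForm_conjTranspose_mul_self]
  exact norm_inner_le_norm _ _

/-- A family of unit vectors maximizes `‖matAction C x‖` over all families in the unit ball. -/
theorem exists_norm_matAction_max [FiniteDimensional ℂ E] (C : Matrix ι ι ℂ) (e : ι → E)
    (he : ∀ i, ‖e i‖ = 1) :
    ∃ x : ι → E, (∀ i, ‖x i‖ = 1) ∧
      ∀ y : ι → E, (∀ i, ‖y i‖ ≤ 1) → ‖matAction C y‖ ≤ ‖matAction C x‖ := by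
  have : ProperSpace E := FiniteDimensional.proper ℂ E
  let _ : NormedSpace ℝ E := NormedSpace.restrictScalars ℝ ℂ E
  have hc : IsCompact (Set.univ.pi fun _ : ι => Metric.sphere (0 : E) 1) :=
    isCompact_univ_pi fun _ => isCompact_sphere _ _
  have hcont : Continuous fun x : ι → E => ‖matAction C x‖ := by
    change Continuous fun x : ι → E =>
      ‖(WithLp.toLp 2 fun l => ∑ i, C l i • x i : PiLp 2 fun _ : ι => E)‖
    fun_prop
  obtain ⟨x, hx, hmax⟩ := hc.exists_isMaxOn ⟨e, by simpa using he⟩ hcont.continuousOn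
  refine ⟨x, by simpa using hx, fun y hy => ?_⟩
  -- A convex function on the product of balls, the convex hull of the product of spheres, is
  -- dominated by its values on the spheres.
  have hconv : ConvexOn ℝ Set.univ fun x : ι → E => ‖matAction C x‖ :=
    (convexOn_univ_norm (E := PiLp 2 fun _ : ι => E)).comp_linearMap
      ((matAction C).restrictScalars ℝ)
  have hmem : y ∈ convexHull ℝ (Set.univ.pi fun _ : ι => Metric.sphere (0 : E) 1) := by
    rw [convexHull_pi]
    intro i _
    have : Nontrivial E := ⟨e i, 0, fun h => by simpa [h] using he i⟩
    rw [convexHull_sphere_eq_closedBall _ zero_le_one]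
    simpa using hy i
  obtain ⟨z, hz, hle⟩ := hconv.exists_ge_of_mem_convexHull (Set.subset_univ _) hmem
  exact hle.trans (hmax hz)

/-- A family indexed by a finite type has the same Gram matrix as some family in the Euclidean
space on that type. -/
theorem exists_euclidean_inner_eq (x : ι → E) :
    ∃ y : ι → EuclideanSpace ℂ ι, ∀ i j, inner ℂ (y i) (y j) = inner ℂ (x i) (x j) := by
  classical
  obtain ⟨W, hW⟩ := (posSemidef_gram ℂ x).exists_eq_conjTranspose_mul_self
  refine ⟨fun j => WithLp.toLp 2 fun l => W l j, fun i j => ?_⟩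
  rw [← gram_apply (𝕜 := ℂ) x, hW]
  simp [mul_apply, PiLp.inner_apply, mul_comm]

/-- The maximum over unit balls in the Euclidean space on the index type bounds the form on unit
balls of every complex inner product space. -/
theorem norm_sesqForm_le_of_max (C : Matrix ι ι ℂ) {m : ℝ}
    (hm : ∀ y : ι → EuclideanSpace ℂ ι, (∀ i, ‖y i‖ ≤ 1) → ‖matAction C y‖ ≤ m)
    (x y : ι → E) (hx : ∀ i, ‖x i‖ ≤ 1) (hy : ∀ i, ‖y i‖ ≤ 1) :
    ‖sesqForm (Cᴴ * C) x y‖ ≤ m ^ 2 := by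
  have key : ∀ x : ι → E, (∀ i, ‖x i‖ ≤ 1) → ‖matAction C x‖ ≤ m := by
    intro x hx
    obtain ⟨z, hz⟩ := exists_euclidean_inner_eq x
    have h1 : sesqForm (Cᴴ * C) z z = sesqForm (Cᴴ * C) x x := by
      simp only [sesqForm, hz]
    rw [sesqForm_self_eq_norm_sq, sesqForm_self_eq_norm_sq, Complex.ofReal_inj] at h1
    rw [← (pow_left_inj₀ (norm_nonneg _) (norm_nonneg _) two_ne_zero).1 h1]
    refine hm z fun i => ?_
    rw [@norm_eq_sqrt_re_inner ℂ, hz, ← @norm_eq_sqrt_re_inner ℂ]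
    exact hx i
  calc _ ≤ ‖matAction C x‖ * ‖matAction C y‖ := norm_sesqForm_le C x y
    _ ≤ m * m := mul_le_mul (key x hx) (key y hy) (norm_nonneg _)
      ((norm_nonneg _).trans (key x hx))
    _ = m ^ 2 := (sq m).symm

theorem trace_mul_transpose_gram (P : Matrix ι ι ℂ) (x : ι → E) :
    (P * (gram ℂ x)ᵀ).trace = sesqForm P x x := by
  simp [trace, mul_apply, sesqForm, gram_apply]

end Sesquilinear

theorem bilinForm_eq_sesqForm {n : ℕ} (P : Matrix (Fin n) (Fin n) ℂ) (a b : AbelianAlg n) :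
    bilinForm P a b = sesqForm P (star a) b := by
  rw [bilinForm_apply, sesqForm]
  refine Finset.sum_congr rfl fun i _ => Finset.sum_congr rfl fun j _ => ?_
  simp [RCLike.inner_apply]
  ring

theorem exists_mem_setR {n : ℕ} (C : Matrix (Fin n) (Fin n) ℂ) :
    ∃ R ∈ setR n, (Cᴴ * C * R).trace = ((normB (Cᴴ * C) : ℝ) : ℂ) := by
  obtain ⟨x, hx, hmax⟩ := exists_norm_matAction_max C (fun _ => (1 : ℂ)) (by simp)
  -- The unitary is `star x`, not `x`: the trace pairs `P i j` with the `(j, i)` entry, so the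
  -- transposed Gram matrix is needed.
  refine ⟨vecMulVec (star (star x)) (star x),
    subset_closure (subset_convexHull ℝ _ ⟨star x, ?_, rfl⟩), ?_⟩
  · rw [Unitary.mem_iff]
    constructor <;> ext i <;>
      simp [Complex.conj_mul', Complex.mul_conj', hx i]
  have htr : (Cᴴ * C * vecMulVec (star (star x)) (star x)).trace = sesqForm (Cᴴ * C) x x := by
    rw [← trace_mul_transpose_gram]
    congr 2
    ext i j
    simp [vecMulVec_apply, gram_apply, RCLike.inner_apply]
  have hB : IsGreatest {r : ℝ | ∃ (a : AbelianAlg n) (b : AbelianAlg n),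
      ‖a‖ ≤ 1 ∧ ‖b‖ ≤ 1 ∧ r = ‖bilinForm (Cᴴ * C) a b‖} (‖matAction C x‖ ^ 2) := by
    constructor
    · refine ⟨star x, x, ?_, ?_, ?_⟩
      · rw [norm_star]
        exact (pi_norm_le_iff_of_nonneg zero_le_one).2 fun i => (hx i).le
      · exact (pi_norm_le_iff_of_nonneg zero_le_one).2 fun i => (hx i).le
      · rw [bilinForm_eq_sesqForm, star_star, sesqForm_self_eq_norm_sq, Complex.norm_real,
          Real.norm_of_nonneg (by positivity)]
    · rintro r ⟨a, b, ha, hb, rfl⟩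
      rw [bilinForm_eq_sesqForm, sq]
      refine (norm_sesqForm_le C _ _).trans (mul_le_mul (hmax _ fun i => ?_) (hmax _ fun i => ?_)
        (norm_nonneg _) (norm_nonneg _))
      · exact (norm_le_pi_norm (star a) i).trans ((norm_star a).trans_le ha)
      · exact (norm_le_pi_norm b i).trans hb
  rw [htr, sesqForm_self_eq_norm_sq, normB, hB.csSup_eq]

-- The coefficient of the amplification at `ξ`, `η` is `∑ P i j ⟨(a i)ᴴ ξ, b j η⟩`, the form on two
-- families in the unit ball of `ℂ ^ k`. Only Gram matrices of `n` vectors matter, so the bound from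
-- `ℂ ^ n` serves every `k`.
open scoped Matrix.Norms.L2Operator in
theorem opNorm_amplify_le {n k : ℕ} (C : Matrix (Fin n) (Fin n) ℂ) {m : ℝ}
    (hm : ∀ y : Fin n → EuclideanSpace ℂ (Fin n), (∀ i, ‖y i‖ ≤ 1) → ‖matAction C y‖ ≤ m)
    (a b : Matrix (Fin k) (Fin k) (AbelianAlg n)) (ha : matNorm a ≤ 1) (hb : matNorm b ≤ 1) :
    opNorm (amplify (bilinForm (Cᴴ * C)) k a b) ≤ m ^ 2 := by
  have ha' : ∀ i, ‖a.map (fun f => f i)‖ ≤ 1 := fun i =>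
    (norm_le_pi_norm (fun j : Fin n => a.map (fun f : AbelianAlg n => f j)) i).trans ha
  have hb' : ∀ i, ‖b.map (fun f => f i)‖ ≤ 1 := fun i =>
    (norm_le_pi_norm (fun j : Fin n => b.map (fun f : AbelianAlg n => f j)) i).trans hb
  rw [opNorm, amplify_bilinForm, cstar_norm_def]
  refine ContinuousLinearMap.opNorm_le_of_re_inner_le (𝕜 := ℂ) (sq_nonneg m)
    fun η ξ hη hξ => ?_
  rw [← inner_conj_symm, RCLike.conj_re]
  refine (RCLike.re_le_norm _).trans ?_
  have hle : ∀ (A : Matrix (Fin k) (Fin k) ℂ) (v : EuclideanSpace ℂ (Fin k)), ‖A‖ ≤ 1 →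
      ‖v‖ = 1 → ‖toEuclideanCLM (𝕜 := ℂ) A v‖ ≤ 1 := fun A v hA hv => by
    have := (toEuclideanCLM (𝕜 := ℂ) A).le_opNorm v
    rw [← cstar_norm_def, hv, mul_one] at this
    exact this.trans hA
  have h := norm_sesqForm_le_of_max C hm
    (fun i => toEuclideanCLM (𝕜 := ℂ) (a.map fun f => f i)ᴴ ξ)
    (fun j => toEuclideanCLM (𝕜 := ℂ) (b.map fun f => f j) η)
    (fun i => hle _ _ (by rw [l2_opNorm_conjTranspose]; exact ha' i) hξ)
    (fun j => hle _ _ (hb' j) hη)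
  refine (congrArg norm ?_).trans_le h
  simp only [sesqForm, map_sum, map_smul, map_mul, _root_.sum_apply,
    _root_.smul_apply, mul_apply_eq_comp, inner_sum, inner_smul_right,
    ← star_eq_conjTranspose, map_star, ContinuousLinearMap.star_eq_adjoint,
    ContinuousLinearMap.adjoint_inner_left]

open scoped Matrix.Norms.L2Operator in
/-- Vectors in the unit ball, as columns of matrices, realize the form as an amplification. -/
theorem exists_opNorm_amplify_eq {n : ℕ} [Nonempty (Fin n)] (P : Matrix (Fin n) (Fin n) ℂ)
    (x : Fin n → EuclideanSpace ℂ (Fin n)) (hx : ∀ i, ‖x i‖ = 1) :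
    ∃ a b : Matrix (Fin n) (Fin n) (AbelianAlg n), matNorm a ≤ 1 ∧ matNorm b ≤ 1 ∧
      ‖sesqForm P x x‖ = opNorm (amplify (bilinForm P) n a b) := by
  obtain ⟨o⟩ := ‹Nonempty (Fin n)›
  -- With `x j` in column `o` and zeros elsewhere, `(B i)ᴴ * B j` is `⟨x i, x j⟩` times the matrix
  -- unit at `(o, o)`.
  let B : Fin n → Matrix (Fin n) (Fin n) ℂ := fun j => vecMulVec (x j) (Pi.single o 1)
  have hBB : ∀ i j, (B i)ᴴ * B j = diagonal (Pi.single o (inner ℂ (x i) (x j))) := by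
    intro i j
    ext r s
    simp only [B, mul_apply, conjTranspose_apply, vecMulVec_apply, diagonal_apply, Pi.single_apply,
      PiLp.inner_apply, RCLike.inner_apply]
    by_cases hr : r = o <;> by_cases hs : s = o <;> simp [hr, hs, mul_comm]
    exact fun h => absurd h.symm hs
  have hB : ∀ i, ‖B i‖ ≤ 1 := by
    intro i
    have h : ‖B i‖ * ‖B i‖ = 1 := by
      rw [← l2_opNorm_conjTranspose_mul_self, hBB, l2_opNorm_diagonal, Pi.norm_single,
        inner_self_eq_norm_sq_to_K, hx i]
      simp
    nlinarith [norm_nonneg (B i)]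
  refine ⟨of fun r s i => (B i)ᴴ r s, of fun r s i => B i r s, ?_, ?_, ?_⟩
  · exact (pi_norm_le_iff_of_nonneg zero_le_one).2 fun i => by
      exact (l2_opNorm_conjTranspose (B i)).trans_le (hB i)
  · exact (pi_norm_le_iff_of_nonneg zero_le_one).2 hB
  · rw [amplify_bilinForm, opNorm]
    have : ∑ i, ∑ j, P i j • (((of fun r s i => (B i)ᴴ r s :
        Matrix (Fin n) (Fin n) (AbelianAlg n)).map fun f => f i) *
        ((of fun r s i => B i r s : Matrix (Fin n) (Fin n) (AbelianAlg n)).map fun f => f j)) =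
        diagonal (Pi.single o (sesqForm P x x)) := by
      calc _ = ∑ i, ∑ j, P i j • ((B i)ᴴ * B j) := rfl
        _ = _ := by
          ext r s
          simp only [hBB, Matrix.sum_apply, Matrix.smul_apply, diagonal_apply, Pi.single_apply, sesqForm,
            smul_eq_mul]
          by_cases hrs : r = s <;> by_cases hr : r = o <;> simp [hrs, hr]
    rw [this, l2_opNorm_diagonal, Pi.norm_single]

theorem exists_mem_setQ {n : ℕ} (C : Matrix (Fin n) (Fin n) ℂ) :
    ∃ Q ∈ setQ n, (Cᴴ * C * Q).trace = ((normCbB (Cᴴ * C) : ℝ) : ℂ) := by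
  obtain ⟨x, hx, hmax⟩ := exists_norm_matAction_max C
    (fun i => EuclideanSpace.single i (1 : ℂ)) (by simp)
  refine ⟨(gram ℂ x)ᵀ, ⟨(posSemidef_gram ℂ x).transpose, fun i => ?_⟩, ?_⟩
  · rw [transpose_apply, gram_apply, inner_self_eq_norm_sq_to_K, hx i]
    simp
  rw [trace_mul_transpose_gram, sesqForm_self_eq_norm_sq, Complex.ofReal_inj]
  refine le_antisymm ?_ (Real.sSup_le ?_ (sq_nonneg _))
  -- For `n = 0` no column can carry the vectors, but the maximum is then `0`.
  · cases isEmpty_or_nonempty (Fin n) with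
    | inl h =>
      have h0 : matAction C x = 0 := by
        ext l
        exact isEmptyElim l
      rw [h0, norm_zero, zero_pow two_ne_zero]
      exact Real.sSup_nonneg (by
        rintro r ⟨k, a, b, -, -, rfl⟩
        exact norm_nonneg (E := EuclideanSpace ℂ (Fin k) →L[ℂ] EuclideanSpace ℂ (Fin k)) _)
    | inr h =>
      obtain ⟨a, b, ha, hb, hab⟩ := exists_opNorm_amplify_eq (Cᴴ * C) x hx
      rw [sesqForm_self_eq_norm_sq, Complex.norm_real, Real.norm_of_nonneg (sq_nonneg _)] at hab
      exact le_csSup (bddAbove_normCbB _) ⟨n, a, b, ha, hb, hab⟩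
  · rintro r ⟨k, a, b, ha, hb, rfl⟩
    exact opNorm_amplify_le C hmax a b ha hb

end GrothendieckNorms

end

theorem mainTheorem11 (n : ℕ) (P : Matrix (Fin n) (Fin n) ℂ) (hP : P.PosSemidef) :
    ∃ R ∈ GrothendieckNorms.setR n, ∃ Q ∈ GrothendieckNorms.setQ n,
      (P * R).trace = ((GrothendieckNorms.normB P : ℝ) : ℂ) ∧
      (P * Q).trace = ((GrothendieckNorms.normCbB P : ℝ) : ℂ) := by
  obtain ⟨C, rfl⟩ := hP.exists_eq_conjTranspose_mul_self
  obtain ⟨R, hR, hR'⟩ := GrothendieckNorms.exists_mem_setR C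
  obtain ⟨Q, hQ, hQ'⟩ := GrothendieckNorms.exists_mem_setQ C
  exact ⟨R, hR, Q, hQ, hR', hQ'⟩
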